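/- Let $(\Omega,\mathcal F,P)$ be a probability space, $\alpha\in(0,1)$, $p\in(1,\infty)$ and $p'=\frac{p}{p-1}$. For a density $Z$ (that is, $Z\ge 0$ a.s. and $\mathbb E Z=1$) with $Z\in L^{p'}$ let $H_{p'}(Z)=\frac{1}{p'-1}\log\mathbb E Z^{p'}$ be its Rényi entropy. For $Y\in L^p$ put $$\mathrm{EVaR}^p_\alpha(Y)=\sup\Big\{\mathbb E YZ:\ Z\in L^{p'},\ Z\ge0,\ \mathbb E Z=1,\ H_{p'}(Z)\le\log\tfrac1{1-\alpha}\Big\},$$ and for $Z\in L^{p'}$ put $$\|Z\|^*_{\alpha,p'}=\sup\{\mathbb E YZ:\ Y\in L^p,\ \mathrm{EVaR}^p_\alpha(|Y|)\le1\}.$$ All these suprema are finite, and the following hold, with $\operatorname{sign}(0)=0$ and $x_+=\max(x,0)$. 1. Let $Y\in L^p$, and suppose that $t^*\in\mathbb R$ attains $$\inf_{t\in\mathbb R}\Big\{t+\Big(\tfrac{1}{1-\alpha}\Big)^{1/p}\big\|(|Y|-t)_+\big\|_p\Big\}$$ and that $t^*<\operatorname{ess\,sup}|Y|$. Then $Z'=\operatorname{sign}(Y)\,(|Y|-t^*)_+^{p-1}$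 is a nonzero element of $L^{p'}$ and attains the supremum in $$\mathrm{EVaR}^p_\alpha(|Y|)=\sup_{0\ne Z\in L^{p'}}\frac{\mathbb E YZ}{\|Z\|^*_{\alpha,p'}},$$ that is, this equality holds and $\mathbb E YZ'/\|Z'\|^*_{\alpha,p'}=\mathrm{EVaR}^p_\alpha(|Y|)$. 2. Let $Z\in L^{p'}$, and suppose that $t^*\in\mathbb R$ attains $$\sup_{t\in\mathbb R}\ \frac{\mathbb E\big(t+|Z|^{p'-1}\big)_+|Z|}{t+\big(\tfrac1{1-\alpha}\big)^{1/p}\big\|\big(t+|Z|^{p'-1}\big)_+-t\big\|_p}$$ (where $0/0=0$, which occurs only for $Z=0$ and $t=0$). Then $Y'=\operatorname{sign}(Z)\,(t^*+|Z|^{p'-1})_+$ lies in $L^p$ and satisfies $$\mathbb E Y'Z=\mathrm{EVaR}^p_\alpha(|Y'|)\cdot\|Z\|^*_{\alpha,p'}.$$ -/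

import Mathlib

open MeasureTheory

noncomputable section

namespace EntropicRisk

variable {Ω : Type*} [MeasurableSpace Ω]

/-- The Rényi entropy `H_q(Z) = (q - 1)⁻¹ * log E[Z ^ q]` of a density `Z`,
for orders `q` other than `0`, `1`, `∞` (only orders `1 < q < ∞` are used here). -/
def renyiEntropy (P : Measure Ω) (q : ℝ) (Z : Ω → ℝ) : ℝ :=
  1 / (q - 1) * Real.log (∫ ω, Z ω ^ q ∂P)

/-- For `1 < p < ∞` with conjugate exponent `p' = p / (p - 1)`: the densities `Z`
(`Z ≥ 0` almost surely, `E Z = 1`), with `E[Z ^ p']` finite, whose Rényi entropy of order `p'`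
is at most `log (1 / (1 - α))`. -/
def feasibleDensities (P : Measure Ω) (p α : ℝ) : Set (Ω → ℝ) :=
  {Z | MemLp Z (ENNReal.ofReal p.conjExponent) P ∧ (∀ᵐ ω ∂P, 0 ≤ Z ω) ∧ ∫ ω, Z ω ∂P = 1 ∧
    renyiEntropy P p.conjExponent Z ≤ Real.log (1 / (1 - α))}

/-- The numbers `E[Y Z]` for feasible densities `Z`. -/
def evarValues (P : Measure Ω) (p α : ℝ) (Y : Ω → ℝ) : Set ℝ :=
  {r | ∃ Z ∈ feasibleDensities P p α, r = ∫ ω, Y ω * Z ω ∂P}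

/-- The Entropic Value-at-Risk of order `p > 1` at level `α`, based on Rényi entropy. -/
def evar (P : Measure Ω) (p α : ℝ) (Y : Ω → ℝ) : ℝ :=
  sSup (evarValues P p α Y)

/-- The numbers `E[Y Z]` for `Y ∈ L^p` in the unit ball of the norm `EVaR(|·|)`. -/
def dualNormValues (P : Measure Ω) (p α : ℝ) (Z : Ω → ℝ) : Set ℝ :=
  {r | ∃ Y : Ω → ℝ, MemLp Y (ENNReal.ofReal p) P ∧ evar P p α (fun ω => |Y ω|) ≤ 1 ∧
    r = ∫ ω, Y ω * Z ω ∂P}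

/-- The dual norm of `EVaR(|·|)`. -/
def dualNorm (P : Measure Ω) (p α : ℝ) (Z : Ω → ℝ) : ℝ :=
  sSup (dualNormValues P p α Z)

/-- The objective `t + (1 / (1 - α)) ^ (1 / p) * ‖(X - t)₊‖_p` of the infimum representation
of `EVaR(X)`. -/
def infObjective (P : Measure Ω) (p α : ℝ) (X : Ω → ℝ) (t : ℝ) : ℝ :=
  t + (1 / (1 - α)) ^ (1 / p) * lpNorm (fun ω => max (X ω - t) 0) (ENNReal.ofReal p) P

/-- The objective of the explicit formula for the dual norm: the quotient of
`E[(t + |Z| ^ (p' - 1))₊ * |Z|]` by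
`t + (1 / (1 - α)) ^ (1 / p) * ‖(t + |Z| ^ (p' - 1))₊ - t‖_p`. -/
def dualObjective (P : Measure Ω) (p α : ℝ) (Z : Ω → ℝ) (t : ℝ) : ℝ :=
  (∫ ω, max (t + |Z ω| ^ (p.conjExponent - 1)) 0 * |Z ω| ∂P) /
    (t + (1 / (1 - α)) ^ (1 / p) *
      lpNorm (fun ω => max (t + |Z ω| ^ (p.conjExponent - 1)) 0 - t) (ENNReal.ofReal p) P)

/-- The random variable `sign(Y) * (|Y| - t)₊ ^ (p - 1)`. -/
def hahnBanachDual (p : ℝ) (Y : Ω → ℝ) (t : ℝ) (ω : Ω) : ℝ :=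
  Real.sign (Y ω) * max (|Y ω| - t) 0 ^ (p - 1)

/-- The random variable `sign(Z) * (t + |Z| ^ (p' - 1))₊`. -/
def hahnBanachPrimal (p : ℝ) (Z : Ω → ℝ) (t : ℝ) (ω : Ω) : ℝ :=
  Real.sign (Z ω) * max (t + |Z ω| ^ (p.conjExponent - 1)) 0

end EntropicRisk

end

noncomputable section

namespace EntropicRisk

open Filter Topology

variable {Ω : Type*} [MeasurableSpace Ω] {P : Measure Ω}

/-! Put C = (1/(1-α))^(1/p) and q = p'. For densities the entropy constraint reads ‖Z‖_q ≤ C, so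
after rescaling E[YW] ≤ EVaR(Y) E[W] whenever W ≥ 0 is admissible: ‖W‖_q ≤ C E[W]. Two weak
dualities follow: EVaR(X) ≤ t + C‖(X-t)₊‖_p for every t (`evar_le_infObjective`), and ‖Z‖* ≤ E[W]
for every admissible W ≥ |Z| (`dualNorm_le_integral`). Equality is needed only at the optimizers.

For Y, the first-order condition at the minimizer t says that V = (|Y|-t)₊^(p-1) is admissible with
equality. Then E[|Y|V] = (t + C‖(|Y|-t)₊‖_p) E[V], which forces EVaR(|Y|) = t + C‖(|Y|-t)₊‖_p and
‖Z'‖* = E[V].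

For Z, the denominator of the objective bounds EVaR(|Y'|), and ‖Z‖* is at most the supremum of the
objective (`dualNorm_le_of_forall_dualObjective_le`). At a maximizer these bounds multiply to
EVaR(|Y'|)‖Z‖* ≤ E[Y'Z]; the converse is the Hölder inequality of the dual pair. -/

theorem one_le_ofReal {p q : ℝ} (hpq : p.HolderConjugate q) : 1 ≤ ENNReal.ofReal p := by
  rw [← ENNReal.ofReal_one]
  exact ENNReal.ofReal_le_ofReal hpq.lt.le

theorem ofReal_ne_zero {p q : ℝ} (hpq : p.HolderConjugate q) : ENNReal.ofReal p ≠ 0 :=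
  (zero_lt_one.trans_le (one_le_ofReal hpq)).ne'

/-! ### Norm identities and Hölder's inequality for `lpNorm`. -/

theorem lpNorm_rpow_eq_integral {r : ℝ} (hr : 0 < r) {f : Ω → ℝ}
    (hf : MemLp f (ENNReal.ofReal r) P) (h₀ : ∀ᵐ ω ∂P, 0 ≤ f ω) :
    lpNorm f (ENNReal.ofReal r) P ^ r = ∫ ω, f ω ^ r ∂P := by
  have hr0 : ENNReal.ofReal r ≠ 0 := by simpa using hr
  rw [lpNorm_eq_integral_norm_rpow_toReal hr0 ENNReal.ofReal_ne_top hf.1,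
    ENNReal.toReal_ofReal hr.le, Real.rpow_inv_rpow (by positivity) hr.ne']
  refine integral_congr_ae ?_
  filter_upwards [h₀] with ω hω
  rw [Real.norm_of_nonneg hω]

theorem memLp_rpow_sub_one {p q : ℝ} (hpq : p.HolderConjugate q) {f : Ω → ℝ}
    (hf : MemLp f (ENNReal.ofReal p) P) (h₀ : ∀ ω, 0 ≤ f ω) :
    MemLp (fun ω => f ω ^ (p - 1)) (ENNReal.ofReal q) P := by
  have h := hf.norm_rpow_div (ENNReal.ofReal (p - 1))
  rw [← ENNReal.ofReal_div_of_pos hpq.sub_one_pos, ← hpq.conjugate_eq,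
    ENNReal.toReal_ofReal hpq.sub_one_pos.le] at h
  simpa [Real.norm_of_nonneg (h₀ _)] using h

theorem lpNorm_rpow_sub_one {p q : ℝ} (hpq : p.HolderConjugate q) {f : Ω → ℝ}
    (hf : MemLp f (ENNReal.ofReal p) P) (h₀ : ∀ ω, 0 ≤ f ω) :
    lpNorm (fun ω => f ω ^ (p - 1)) (ENNReal.ofReal q) P =
      lpNorm f (ENNReal.ofReal p) P ^ (p - 1) := by
  have h₁ := lpNorm_rpow_eq_integral hpq.symm.pos (memLp_rpow_sub_one hpq hf h₀)
    (ae_of_all _ fun ω => Real.rpow_nonneg (h₀ ω) _)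
  have h₂ : ∫ ω, (f ω ^ (p - 1)) ^ q ∂P = ∫ ω, f ω ^ p ∂P := by
    congr with ω
    rw [← Real.rpow_mul (h₀ ω), hpq.sub_one_mul_conj]
  rw [h₂, ← lpNorm_rpow_eq_integral hpq.pos hf (ae_of_all _ h₀)] at h₁
  rw [← Real.rpow_left_inj lpNorm_nonneg (Real.rpow_nonneg lpNorm_nonneg _) hpq.symm.pos.ne', h₁,
    ← Real.rpow_mul lpNorm_nonneg, hpq.sub_one_mul_conj]

theorem integrable_mul_of_memLp {p q : ℝ} (hpq : p.HolderConjugate q) {f g : Ω → ℝ}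
    (hf : MemLp f (ENNReal.ofReal p) P) (hg : MemLp g (ENNReal.ofReal q) P) :
    Integrable (fun ω => f ω * g ω) P := by
  have : ENNReal.HolderConjugate (ENNReal.ofReal p) (ENNReal.ofReal q) :=
    ENNReal.holderConjugate_iff.2 hpq.inv_add_inv_ennreal
  exact hf.integrable_mul hg

theorem integral_mul_le_lpNorm_mul_lpNorm {p q : ℝ} (hpq : p.HolderConjugate q) {f g : Ω → ℝ}
    (hf : MemLp f (ENNReal.ofReal p) P) (hg : MemLp g (ENNReal.ofReal q) P) :
    ∫ ω, f ω * g ω ∂P ≤ lpNorm f (ENNReal.ofReal p) P * lpNorm g (ENNReal.ofReal q) P := by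
  have h := integral_mul_norm_le_Lp_mul_Lq hpq hf hg
  rw [lpNorm_eq_integral_norm_rpow_toReal (ofReal_ne_zero hpq) ENNReal.ofReal_ne_top hf.1,
    lpNorm_eq_integral_norm_rpow_toReal (ofReal_ne_zero hpq.symm) ENNReal.ofReal_ne_top hg.1,
    ENNReal.toReal_ofReal hpq.nonneg, ENNReal.toReal_ofReal hpq.symm.nonneg]
  simp only [one_div] at h
  refine (integral_mono (integrable_mul_of_memLp hpq hf hg)
    (integrable_mul_of_memLp hpq hf.norm hg.norm) fun ω => ?_).trans h
  simpa using le_abs_self (f ω * g ω)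

theorem lpNorm_const_of_nonneg [IsProbabilityMeasure P] {p q : ℝ} (hpq : p.HolderConjugate q)
    {c : ℝ} (hc : 0 ≤ c) : lpNorm (fun _ : Ω => c) (ENNReal.ofReal p) P = c := by
  rw [lpNorm_const (ofReal_ne_zero hpq) (IsProbabilityMeasure.ne_zero P)]
  simp [abs_of_nonneg hc]

theorem integral_le_lpNorm [IsProbabilityMeasure P] {p q : ℝ} (hpq : p.HolderConjugate q)
    {f : Ω → ℝ} (hf : MemLp f (ENNReal.ofReal p) P) :
    ∫ ω, f ω ∂P ≤ lpNorm f (ENNReal.ofReal p) P := by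
  simpa [lpNorm_const_of_nonneg hpq.symm zero_le_one] using
    integral_mul_le_lpNorm_mul_lpNorm hpq hf (memLp_const (1 : ℝ))

theorem lpNorm_le_add_of_le [IsProbabilityMeasure P] {p q : ℝ} (hpq : p.HolderConjugate q)
    {f g : Ω → ℝ} {c : ℝ} (hg : MemLp g (ENNReal.ofReal p) P) (hc : 0 ≤ c)
    (h₀ : ∀ ω, 0 ≤ f ω) (h : ∀ ω, f ω ≤ g ω + c) :
    lpNorm f (ENNReal.ofReal p) P ≤ lpNorm g (ENNReal.ofReal p) P + c := by
  have h₁ : lpNorm f (ENNReal.ofReal p) P ≤ lpNorm (g + fun _ => c) (ENNReal.ofReal p) P :=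
    lpNorm_mono_real (hg.add (memLp_const c)) fun ω => by
      simpa [Real.norm_of_nonneg (h₀ ω)] using h ω
  refine h₁.trans ((lpNorm_add_le hg (one_le_ofReal hpq)).trans ?_)
  rw [lpNorm_const_of_nonneg hpq hc]

theorem integral_mul_rpow_sub_one_self {p q : ℝ} (hpq : p.HolderConjugate q) {f : Ω → ℝ}
    (hf : MemLp f (ENNReal.ofReal p) P) (h₀ : ∀ ω, 0 ≤ f ω) :
    ∫ ω, f ω * f ω ^ (p - 1) ∂P =
      lpNorm f (ENNReal.ofReal p) P * lpNorm f (ENNReal.ofReal p) P ^ (p - 1) := by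
  have h : ∀ x : ℝ, 0 ≤ x → x * x ^ (p - 1) = x ^ p := fun x hx => by
    rw [mul_comm, ← Real.rpow_add_one' hx (by linarith [hpq.pos]), sub_add_cancel]
  simp_rw [fun ω => h _ (h₀ ω)]
  rw [h _ lpNorm_nonneg, lpNorm_rpow_eq_integral hpq.pos hf (ae_of_all _ h₀)]

theorem memLp_max_sub [IsFiniteMeasure P] {r : ENNReal} {X : Ω → ℝ} (hX : MemLp X r P) (s : ℝ) :
    MemLp (fun ω => max (X ω - s) 0) r P :=
  (hX.sub (memLp_const s)).pos_part

/-! ### The entropy constraint as a norm bound. -/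

/-- The bound on the norm of a density that is equivalent to the bound on its entropy. -/
def entropyBound (p α : ℝ) : ℝ := (1 / (1 - α)) ^ (1 / p)

theorem one_lt_entropyBound {p q α : ℝ} (hpq : p.HolderConjugate q) (hα₀ : 0 < α) (hα₁ : α < 1) :
    1 < entropyBound p α :=
  Real.one_lt_rpow (by rw [lt_div_iff₀ (by linarith)]; linarith) hpq.one_div_pos

/-- Exponentiating gives E[Z^q] ≤ (1/(1-α))^(q-1); the q-th root has exponent (q-1)/q = 1/p. -/
theorem mem_feasibleDensities_iff {p q α : ℝ} (hpq : p.HolderConjugate q) (hα₁ : α < 1)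
    {Z : Ω → ℝ} :
    Z ∈ feasibleDensities P p α ↔ MemLp Z (ENNReal.ofReal q) P ∧ (∀ᵐ ω ∂P, 0 ≤ Z ω) ∧
      ∫ ω, Z ω ∂P = 1 ∧ lpNorm Z (ENNReal.ofReal q) P ≤ entropyBound p α := by
  rw [feasibleDensities, Set.mem_ofPred_eq, hpq.conjExponent_eq]
  refine and_congr_right fun hZ => and_congr_right fun h₀ => and_congr_right fun h₁ => ?_
  have hK : 0 < 1 / (1 - α) := one_div_pos.2 (by linarith)
  have hn : 0 < lpNorm Z (ENNReal.ofReal q) P := by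
    refine lpNorm_nonneg.lt_of_ne' fun h => ?_
    rw [lpNorm_eq_zero hZ (ofReal_ne_zero hpq.symm)] at h
    simp [integral_congr_ae h] at h₁
  have hq := hpq.symm.sub_one_pos
  rw [renyiEntropy, ← lpNorm_rpow_eq_integral hpq.symm.pos hZ h₀, one_div_mul_eq_div,
    div_le_iff₀ hq, mul_comm, ← Real.log_rpow hK,
    Real.log_le_log_iff (Real.rpow_pos_of_pos hn _) (Real.rpow_pos_of_pos hK _),
    ← Real.rpow_le_rpow_iff hn.le (y := entropyBound p α) (Real.rpow_nonneg hK.le _) hpq.symm.pos,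
    entropyBound, ← Real.rpow_mul hK.le, one_div_mul_eq_div, hpq.symm.div_conj_eq_sub_one]

/-! ### Bounds on EVaR. -/

theorem bddAbove_evarValues {p q α : ℝ} (hpq : p.HolderConjugate q) (hα₁ : α < 1) {Y : Ω → ℝ}
    (hY : MemLp Y (ENNReal.ofReal p) P) : BddAbove (evarValues P p α Y) := by
  refine ⟨lpNorm Y (ENNReal.ofReal p) P * entropyBound p α, ?_⟩
  rintro _ ⟨Z, hZ, rfl⟩
  obtain ⟨hZ, -, -, hn⟩ := (mem_feasibleDensities_iff hpq hα₁).1 hZ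
  exact (integral_mul_le_lpNorm_mul_lpNorm hpq hY hZ).trans
    (mul_le_mul_of_nonneg_left hn lpNorm_nonneg)

theorem evar_le [IsProbabilityMeasure P] {p q α : ℝ} (hpq : p.HolderConjugate q) (hα₀ : 0 < α)
    (hα₁ : α < 1) {Y : Ω → ℝ} {r : ℝ}
    (h : ∀ Z : Ω → ℝ, MemLp Z (ENNReal.ofReal q) P → (∀ᵐ ω ∂P, 0 ≤ Z ω) → ∫ ω, Z ω ∂P = 1 →
      lpNorm Z (ENNReal.ofReal q) P ≤ entropyBound p α → ∫ ω, Y ω * Z ω ∂P ≤ r) :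
    evar P p α Y ≤ r := by
  -- The density 1 is feasible because C > 1, so the supremum is over a nonempty set.
  refine csSup_le ⟨_, fun _ => 1, (mem_feasibleDensities_iff hpq hα₁).2
    ⟨memLp_const _, by simp, by simp, ?_⟩, rfl⟩ ?_
  · rw [lpNorm_const_of_nonneg hpq.symm zero_le_one]
    exact (one_lt_entropyBound hpq hα₀ hα₁).le
  · rintro _ ⟨Z, hZ, rfl⟩
    obtain ⟨h₁, h₂, h₃, h₄⟩ := (mem_feasibleDensities_iff hpq hα₁).1 hZ
    exact h Z h₁ h₂ h₃ h₄

/-- Homogeneous form of the definition: W is divided by its mean, and vanishes almost surely if the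
mean is 0. -/
theorem integral_mul_le_evar_mul {p q α : ℝ} [IsProbabilityMeasure P] (hpq : p.HolderConjugate q)
    (hα₁ : α < 1) {Y W : Ω → ℝ} (hY : MemLp Y (ENNReal.ofReal p) P)
    (hW : MemLp W (ENNReal.ofReal q) P) (h₀ : ∀ᵐ ω ∂P, 0 ≤ W ω)
    (hn : lpNorm W (ENNReal.ofReal q) P ≤ entropyBound p α * ∫ ω, W ω ∂P) :
    ∫ ω, Y ω * W ω ∂P ≤ evar P p α Y * ∫ ω, W ω ∂P := by
  have hWi : Integrable W P := hW.integrable (one_le_ofReal hpq.symm)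
  rcases (integral_nonneg_of_ae h₀).eq_or_lt with h | h
  · rw [← h]
    have h' := (integral_eq_zero_iff_of_nonneg_ae h₀ hWi).1 h.symm
    rw [integral_eq_zero_of_ae, mul_zero]
    filter_upwards [h'] with ω hω
    simp [hω]
  · rw [← div_le_iff₀ h]
    refine le_csSup (bddAbove_evarValues hpq hα₁ hY) ⟨fun ω => (∫ ω, W ω ∂P)⁻¹ * W ω,
      (mem_feasibleDensities_iff hpq hα₁).2 ⟨hW.const_mul _, ?_, ?_, ?_⟩, ?_⟩
    · filter_upwards [h₀] with ω hω
      positivity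
    · rw [integral_const_mul, inv_mul_cancel₀ h.ne']
    · have := lpNorm_const_smul (p := ENNReal.ofReal q) (∫ ω, W ω ∂P)⁻¹ W P
      simp only [Pi.smul_def, smul_eq_mul] at this
      rw [this]
      simp only [coe_nnnorm, norm_inv, Real.norm_of_nonneg h.le]
      rw [inv_mul_le_iff₀ h, mul_comm]
      exact hn
    · rw [div_eq_inv_mul, ← integral_const_mul]
      congr with ω
      ring

theorem integral_le_evar [IsProbabilityMeasure P] {p q α : ℝ} (hpq : p.HolderConjugate q)
    (hα₀ : 0 < α) (hα₁ : α < 1) {Y : Ω → ℝ} (hY : MemLp Y (ENNReal.ofReal p) P) :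
    ∫ ω, Y ω ∂P ≤ evar P p α Y := by
  simpa using integral_mul_le_evar_mul hpq hα₁ hY (memLp_const 1) (by simp)
    (by simpa [lpNorm_const_of_nonneg hpq.symm zero_le_one] using
      (one_lt_entropyBound hpq hα₀ hα₁).le)

theorem evar_abs_nonneg [IsProbabilityMeasure P] {p q α : ℝ} (hpq : p.HolderConjugate q)
    (hα₀ : 0 < α) (hα₁ : α < 1) {Y : Ω → ℝ} (hY : MemLp Y (ENNReal.ofReal p) P) :
    0 ≤ evar P p α (fun ω => |Y ω|) :=
  (integral_nonneg fun _ => abs_nonneg _).trans (integral_le_evar hpq hα₀ hα₁ hY.abs)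

/-- Y ≤ t + (X-t)₊, then Hölder. A majorant X is allowed because |Y'| can lie below (t + |Z|^(q-1))₊
where Z = 0, as sign(0) = 0. -/
theorem evar_le_infObjective [IsProbabilityMeasure P] {p q α : ℝ} (hpq : p.HolderConjugate q)
    (hα₀ : 0 < α) (hα₁ : α < 1) {Y X : Ω → ℝ} (hY : MemLp Y (ENNReal.ofReal p) P)
    (hX : MemLp X (ENNReal.ofReal p) P) (hYX : ∀ ω, Y ω ≤ X ω) (t : ℝ) :
    evar P p α Y ≤ infObjective P p α X t := by
  refine evar_le hpq hα₀ hα₁ fun Z hZ h₀ h₁ hn => ?_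
  have hS := memLp_max_sub hX t
  have hZi := hZ.integrable (one_le_ofReal hpq.symm)
  have hle : ∫ ω, Y ω * Z ω ∂P ≤ ∫ ω, t * Z ω + max (X ω - t) 0 * Z ω ∂P := by
    refine integral_mono_ae (integrable_mul_of_memLp hpq hY hZ)
      ((hZi.const_mul t).add (integrable_mul_of_memLp hpq hS hZ)) ?_
    filter_upwards [h₀] with ω hω
    rw [← add_mul]
    exact mul_le_mul_of_nonneg_right (by linarith [hYX ω, le_max_left (X ω - t) 0]) hω
  rw [integral_add (hZi.const_mul t) (integrable_mul_of_memLp hpq hS hZ), integral_const_mul, h₁,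
    mul_one] at hle
  refine hle.trans (add_le_add_right ((integral_mul_le_lpNorm_mul_lpNorm hpq hS hZ).trans ?_) _)
  rw [mul_comm]
  exact mul_le_mul_of_nonneg_right hn lpNorm_nonneg

/-- The p-norm is controlled by EVaR(|·|), which makes the dual norm finite. The test variable is
the Hölder extremal |Y|^(p-1) plus a constant large enough to make it admissible. -/
theorem lpNorm_le_evar_abs [IsProbabilityMeasure P] {p q α : ℝ} (hpq : p.HolderConjugate q)
    (hα₀ : 0 < α) (hα₁ : α < 1) {Y : Ω → ℝ} (hY : MemLp Y (ENNReal.ofReal p) P) :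
    lpNorm Y (ENNReal.ofReal p) P ≤
      entropyBound p α / (entropyBound p α - 1) * evar P p α (fun ω => |Y ω|) := by
  have hYa : MemLp (fun ω => |Y ω|) (ENNReal.ofReal p) P := hY.abs
  have hC := one_lt_entropyBound hpq hα₀ hα₁
  have hρ := evar_abs_nonneg hpq hα₀ hα₁ hY
  set C := entropyBound p α
  rw [← lpNorm_fun_abs hY.1]
  set n := lpNorm (fun ω => |Y ω|) (ENNReal.ofReal p) P with hn
  have hC' : 0 < C - 1 := by linarith
  have hn₀ : 0 ≤ n := lpNorm_nonneg
  rcases hn₀.eq_or_lt with h | h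
  · rw [← h]
    positivity
  set V : Ω → ℝ := fun ω => |Y ω| ^ (p - 1) with hV
  have hVm : MemLp V (ENNReal.ofReal q) P := memLp_rpow_sub_one hpq hYa fun _ => abs_nonneg _
  have hVn : lpNorm V (ENNReal.ofReal q) P = n ^ (p - 1) :=
    lpNorm_rpow_sub_one hpq hYa fun _ => abs_nonneg _
  have hV₀ : ∀ ω, 0 ≤ V ω := fun ω => Real.rpow_nonneg (abs_nonneg _) _
  have hVi := hVm.integrable (one_le_ofReal hpq.symm)
  have hm : 0 < n ^ (p - 1) := Real.rpow_pos_of_pos h _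
  set m := n ^ (p - 1) with hmdef
  -- This k solves m + k = C k, so ‖V + k‖_q ≤ C k ≤ C E[V + k].
  set k := m / (C - 1) with hk
  have hk₀ : 0 < k := by positivity
  have hkC : m + k = C * k := by rw [hk]; field_simp; ring
  have hWn : lpNorm (fun ω => V ω + k) (ENNReal.ofReal q) P ≤ m + k :=
    hVn ▸ lpNorm_le_add_of_le hpq.symm hVm hk₀.le (fun ω => add_nonneg (hV₀ ω) hk₀.le)
      fun ω => le_rfl
  have hWi : ∫ ω, (V ω + k) ∂P = ∫ ω, V ω ∂P + k := by
    rw [integral_add hVi (integrable_const k)]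
    simp
  have hV1 : 0 ≤ ∫ ω, V ω ∂P := integral_nonneg hV₀
  have h₁ := integral_mul_le_evar_mul (α := α) hpq hα₁ hYa (hVm.add (memLp_const k))
    (ae_of_all _ fun ω => add_nonneg (hV₀ ω) hk₀.le) (by
      refine hWn.trans ?_
      simp only [Pi.add_apply]
      rw [hWi, hkC]
      exact mul_le_mul_of_nonneg_left (by linarith) (by linarith))
  simp only [Pi.add_apply] at h₁
  have h₂ : n * m ≤ ∫ ω, |Y ω| * (V ω + k) ∂P := by
    rw [hmdef, hn, ← integral_mul_rpow_sub_one_self hpq hYa fun _ => abs_nonneg _]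
    refine integral_mono (integrable_mul_of_memLp hpq hYa hVm)
      (integrable_mul_of_memLp hpq hYa (hVm.add (memLp_const k))) fun ω => ?_
    exact mul_le_mul_of_nonneg_left (by linarith) (abs_nonneg _)
  have h₃ : ∫ ω, (V ω + k) ∂P ≤ C / (C - 1) * m := by
    have h := (integral_le_lpNorm hpq.symm (hVm.add (memLp_const k))).trans hWn
    simp only [Pi.add_apply] at h
    rw [hkC, hk] at h
    rw [div_mul_eq_mul_div, ← mul_div_assoc']
    exact h
  have h₄ := (h₂.trans h₁).trans (mul_le_mul_of_nonneg_left h₃ hρ)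
  refine le_of_mul_le_mul_right (h₄.trans_eq ?_) hm
  ring

theorem integral_mul_le_mul_lpNorm [IsProbabilityMeasure P] {p q α : ℝ}
    (hpq : p.HolderConjugate q) (hα₀ : 0 < α) (hα₁ : α < 1) {Y Z : Ω → ℝ}
    (hY : MemLp Y (ENNReal.ofReal p) P) (hZ : MemLp Z (ENNReal.ofReal q) P) :
    ∫ ω, Y ω * Z ω ∂P ≤ entropyBound p α / (entropyBound p α - 1) *
      lpNorm Z (ENNReal.ofReal q) P * evar P p α (fun ω => |Y ω|) := by
  refine (integral_mul_le_lpNorm_mul_lpNorm hpq hY hZ).trans ?_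
  rw [mul_right_comm]
  exact mul_le_mul_of_nonneg_right (lpNorm_le_evar_abs hpq hα₀ hα₁ hY) lpNorm_nonneg

/-! ### The dual norm and its Hölder inequality. -/

theorem bddAbove_dualNormValues [IsProbabilityMeasure P] {p q α : ℝ} (hpq : p.HolderConjugate q)
    (hα₀ : 0 < α) (hα₁ : α < 1) {Z : Ω → ℝ} (hZ : MemLp Z (ENNReal.ofReal q) P) :
    BddAbove (dualNormValues P p α Z) := by
  refine ⟨entropyBound p α / (entropyBound p α - 1) * lpNorm Z (ENNReal.ofReal q) P, ?_⟩
  rintro _ ⟨Y, hY, hY₁, rfl⟩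
  have hC := one_lt_entropyBound hpq hα₀ hα₁
  have hC' : 0 < entropyBound p α - 1 := by linarith
  refine (integral_mul_le_mul_lpNorm hpq hα₀ hα₁ hY hZ).trans (mul_le_of_le_one_right ?_ hY₁)
  exact mul_nonneg (by positivity) lpNorm_nonneg

theorem dualNorm_nonneg [IsProbabilityMeasure P] {p q α : ℝ} (hpq : p.HolderConjugate q)
    (hα₀ : 0 < α) (hα₁ : α < 1) {Z : Ω → ℝ} (hZ : MemLp Z (ENNReal.ofReal q) P) :
    0 ≤ dualNorm P p α Z := by
  refine le_csSup (bddAbove_dualNormValues hpq hα₀ hα₁ hZ) ⟨fun _ => 0, memLp_const 0, ?_, by simp⟩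
  exact evar_le hpq hα₀ hα₁ fun _ _ _ _ _ => by simp

theorem integral_mul_le_evar_mul_dualNorm [IsProbabilityMeasure P] {p q α : ℝ}
    (hpq : p.HolderConjugate q) (hα₀ : 0 < α) (hα₁ : α < 1) {Y Z : Ω → ℝ}
    (hY : MemLp Y (ENNReal.ofReal p) P) (hZ : MemLp Z (ENNReal.ofReal q) P) :
    ∫ ω, Y ω * Z ω ∂P ≤ evar P p α (fun ω => |Y ω|) * dualNorm P p α Z := by
  have hρ := evar_abs_nonneg hpq hα₀ hα₁ hY
  have h := integral_mul_le_mul_lpNorm hpq hα₀ hα₁ hY hZ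
  set ρ := evar P p α (fun ω => |Y ω|) with hρdef
  rcases hρ.eq_or_lt with h₀ | h₀
  -- Y cannot be normalized when EVaR(|Y|) = 0; the p-norm comparison then gives E[YZ] ≤ 0.
  · simpa [← h₀] using h
  · rw [← inv_mul_le_iff₀ h₀, ← integral_const_mul]
    refine le_csSup (bddAbove_dualNormValues hpq hα₀ hα₁ hZ)
      ⟨fun ω => ρ⁻¹ * Y ω, hY.const_mul _, ?_, by simp only [mul_assoc]⟩
    refine evar_le hpq hα₀ hα₁ fun W hW hW₀ hW₁ hn => ?_
    simp only [abs_mul, abs_inv, abs_of_pos h₀, mul_assoc]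
    rw [integral_const_mul, inv_mul_le_iff₀ h₀]
    simpa [hW₁] using integral_mul_le_evar_mul (α := α) hpq hα₁
      (show MemLp (fun ω => |Y ω|) (ENNReal.ofReal p) P from hY.abs) hW hW₀ (by simpa [hW₁])

theorem dualNorm_le_integral [IsProbabilityMeasure P] {p q α : ℝ} (hpq : p.HolderConjugate q)
    (hα₀ : 0 < α) (hα₁ : α < 1) {Z W : Ω → ℝ} (hZ : MemLp Z (ENNReal.ofReal q) P)
    (hW : MemLp W (ENNReal.ofReal q) P) (hZW : ∀ ω, |Z ω| ≤ W ω)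
    (hn : lpNorm W (ENNReal.ofReal q) P ≤ entropyBound p α * ∫ ω, W ω ∂P) :
    dualNorm P p α Z ≤ ∫ ω, W ω ∂P := by
  have hW₀ : ∀ ω, 0 ≤ W ω := fun ω => (abs_nonneg _).trans (hZW ω)
  refine csSup_le ⟨_, fun _ => 0, memLp_const 0,
    evar_le hpq hα₀ hα₁ fun _ _ _ _ _ => by simp, rfl⟩ ?_
  rintro _ ⟨Y, hY, hY₁, rfl⟩
  have h₁ : ∫ ω, Y ω * Z ω ∂P ≤ ∫ ω, |Y ω| * W ω ∂P := by
    refine integral_mono (integrable_mul_of_memLp hpq hY hZ)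
      (integrable_mul_of_memLp hpq hY.abs hW) fun ω => ?_
    refine (le_abs_self _).trans ?_
    rw [abs_mul]
    exact mul_le_mul_of_nonneg_left (hZW ω) (abs_nonneg _)
  refine (h₁.trans (integral_mul_le_evar_mul hpq hα₁ hY.abs hW (ae_of_all _ hW₀) hn)).trans ?_
  exact mul_le_of_le_one_left (integral_nonneg hW₀) hY₁

/-! ### Multiplication by the sign. -/

theorem measurable_real_sign : Measurable Real.sign := by
  unfold Real.sign
  exact Measurable.ite measurableSet_Iio measurable_const
    (Measurable.ite measurableSet_Ioi measurable_const measurable_const)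

theorem abs_sign_mul_le (x : ℝ) {y : ℝ} (hy : 0 ≤ y) : |Real.sign x * y| ≤ y := by
  rcases Real.sign_apply_eq x with h | h | h <;> simp [h, abs_of_nonneg hy, hy]

theorem mul_sign_eq_abs (x : ℝ) : x * Real.sign x = |x| := by
  rcases lt_trichotomy x 0 with h | rfl | h
  · rw [Real.sign_of_neg h, abs_of_neg h, mul_neg_one]
  · simp
  · rw [Real.sign_of_pos h, abs_of_pos h, mul_one]

theorem memLp_sign_mul {r : ENNReal} {X V : Ω → ℝ} (hX : AEStronglyMeasurable X P)
    (hV : MemLp V r P) (h₀ : ∀ ω, 0 ≤ V ω) : MemLp (fun ω => Real.sign (X ω) * V ω) r P := by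
  refine hV.of_le ((measurable_real_sign.comp_aemeasurable
    hX.aemeasurable).aestronglyMeasurable.mul hV.1) (ae_of_all _ fun ω => ?_)
  rw [Real.norm_eq_abs, Real.norm_of_nonneg (h₀ ω)]
  exact abs_sign_mul_le _ (h₀ ω)

/-! ### Continuity in the threshold and the first-order condition. -/

theorem continuous_lpNorm_of_lipschitz [IsProbabilityMeasure P] {p q : ℝ}
    (hpq : p.HolderConjugate q) {f : ℝ → Ω → ℝ} (hf : ∀ s, MemLp (f s) (ENNReal.ofReal p) P)
    (h₀ : ∀ s ω, 0 ≤ f s ω) (h : ∀ s t ω, f s ω ≤ f t ω + |s - t|) :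
    Continuous fun s => lpNorm (f s) (ENNReal.ofReal p) P :=
  (LipschitzWith.of_le_add fun s t =>
    lpNorm_le_add_of_le hpq (hf t) (abs_nonneg (s - t)) (h₀ s) (h s t)).continuous

theorem continuous_integral_max_sub_rpow [IsProbabilityMeasure P] {p q : ℝ}
    (hpq : p.HolderConjugate q) {X : Ω → ℝ} (hX : MemLp X (ENNReal.ofReal p) P) :
    Continuous fun s => ∫ ω, max (X ω - s) 0 ^ (p - 1) ∂P := by
  have hp := hpq.sub_one_pos
  have hm : ∀ s, MemLp (fun ω => max (X ω - s) 0 ^ (p - 1)) (ENNReal.ofReal q) P := fun s =>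
    memLp_rpow_sub_one hpq (memLp_max_sub hX s) fun _ => le_max_right _ _
  refine continuous_iff_continuousAt.2 fun s₀ => continuousAt_of_dominated
    (bound := fun ω => max (X ω - (s₀ - 1)) 0 ^ (p - 1)) (Eventually.of_forall fun s => (hm s).1) ?_
    ((hm _).integrable (one_le_ofReal hpq.symm)) (ae_of_all _ fun ω => ?_)
  · filter_upwards [lt_mem_nhds (sub_one_lt s₀)] with s hs
    refine ae_of_all _ fun ω => ?_
    rw [Real.norm_of_nonneg (by positivity)]
    gcongr
  · exact ((continuous_const.sub continuous_id).max continuous_const).continuousAt.rpow_const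
      (Or.inr hp.le)

theorem max_sub_mul_rpow {r : ℝ} (hr : 0 < r) (x s : ℝ) :
    x * max (x - s) 0 ^ r = max (x - s) 0 * max (x - s) 0 ^ r + s * max (x - s) 0 ^ r := by
  rcases le_total (x - s) 0 with h | h
  · simp [max_eq_right h, Real.zero_rpow hr.ne']
  · rw [max_eq_left h]
    ring

theorem integral_mul_max_sub_rpow [IsProbabilityMeasure P] {p q : ℝ} (hpq : p.HolderConjugate q)
    {X : Ω → ℝ} (hX : MemLp X (ENNReal.ofReal p) P) (s : ℝ) :
    ∫ ω, X ω * max (X ω - s) 0 ^ (p - 1) ∂P =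
      lpNorm (fun ω => max (X ω - s) 0) (ENNReal.ofReal p) P *
        lpNorm (fun ω => max (X ω - s) 0) (ENNReal.ofReal p) P ^ (p - 1) +
      s * ∫ ω, max (X ω - s) 0 ^ (p - 1) ∂P := by
  have hS := memLp_max_sub hX s
  have h₀ : ∀ ω, 0 ≤ max (X ω - s) 0 := fun _ => le_max_right _ _
  have hV := memLp_rpow_sub_one hpq hS h₀
  rw [← integral_mul_rpow_sub_one_self hpq hS h₀, ← integral_const_mul,
    ← integral_add (integrable_mul_of_memLp hpq hS hV)
      ((hV.integrable (one_le_ofReal hpq.symm)).const_mul s)]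
  exact integral_congr_ae (ae_of_all _ fun ω => max_sub_mul_rpow hpq.sub_one_pos _ _)

/-- The first-order condition for a minimizer of the objective of the infimum representation. -/
theorem entropyBound_mul_integral_eq_of_isMinOn [IsProbabilityMeasure P] {p q α : ℝ}
    (hpq : p.HolderConjugate q) (hα₀ : 0 < α) (hα₁ : α < 1) {X : Ω → ℝ}
    (hX : MemLp X (ENNReal.ofReal p) P) {t : ℝ}
    (ht : IsMinOn (infObjective P p α X) Set.univ t) :
    entropyBound p α * ∫ ω, max (X ω - t) 0 ^ (p - 1) ∂P =
      lpNorm (fun ω => max (X ω - t) 0) (ENNReal.ofReal p) P ^ (p - 1) := by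
  have hC : 0 < entropyBound p α := zero_lt_one.trans (one_lt_entropyBound hpq hα₀ hα₁)
  have hmin : ∀ s, t + entropyBound p α * lpNorm (fun ω => max (X ω - t) 0) (ENNReal.ofReal p) P ≤
      s + entropyBound p α * lpNorm (fun ω => max (X ω - s) 0) (ENNReal.ofReal p) P := fun s =>
    ht (Set.mem_univ s)
  set n : ℝ → ℝ := fun s => lpNorm (fun ω => max (X ω - s) 0) (ENNReal.ofReal p) P with hn
  set a : ℝ → ℝ := fun s => ∫ ω, max (X ω - s) 0 ^ (p - 1) ∂P with ha
  have hS := memLp_max_sub hX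
  have h₀ : ∀ s ω, 0 ≤ max (X ω - s) 0 := fun _ _ => le_max_right _ _
  have hn₀ : ∀ s, 0 ≤ n s := fun _ => lpNorm_nonneg
  have hnc : Continuous n := continuous_lpNorm_of_lipschitz hpq hS h₀ fun s r ω => by
    refine max_le ?_ (by positivity)
    linarith [le_max_left (X ω - r) 0, neg_abs_le (s - r)]
  have hg : Continuous fun s => entropyBound p α * a s - n s ^ (p - 1) :=
    (continuous_const.mul (continuous_integral_max_sub_rpow hpq hX)).sub
      (hnc.rpow_const fun _ => Or.inr hpq.sub_one_pos.le)
  -- This replaces differentiation: minimality of t is combined with Hölder for (X-t)₊ against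
  -- (X-s)₊^(p-1). Letting s tend to t from each side gives the two inequalities.
  have key : ∀ s, (s - t) * (entropyBound p α * a s - n s ^ (p - 1)) ≤ 0 := fun s => by
    have hV := memLp_rpow_sub_one hpq (hS s) (h₀ s)
    have h₁ : ∫ ω, (X ω - t) * max (X ω - s) 0 ^ (p - 1) ∂P ≤ n t * n s ^ (p - 1) := by
      simp only [hn]
      rw [← lpNorm_rpow_sub_one hpq (hS s) (h₀ s)]
      refine (integral_mono (integrable_mul_of_memLp hpq (hX.sub (memLp_const t)) hV)
        (integrable_mul_of_memLp hpq (hS t) hV) fun ω => ?_).trans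
        (integral_mul_le_lpNorm_mul_lpNorm hpq (hS t) hV)
      exact mul_le_mul_of_nonneg_right (le_max_left _ _) (Real.rpow_nonneg (h₀ s ω) _)
    simp only [sub_mul] at h₁
    rw [integral_sub (integrable_mul_of_memLp hpq hX hV)
      ((hV.integrable (one_le_ofReal hpq.symm)).const_mul t), integral_const_mul,
      integral_mul_max_sub_rpow hpq hX] at h₁
    change n s * n s ^ (p - 1) + s * a s - t * a s ≤ _ at h₁
    nlinarith [mul_le_mul_of_nonneg_right (hmin s) (Real.rpow_nonneg (hn₀ s) (p - 1)),
      mul_le_mul_of_nonneg_left h₁ hC.le]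
  refine sub_eq_zero.1 (le_antisymm (b := (0 : ℝ)) ?_ ?_)
  · refine le_of_tendsto (hg.tendsto t |>.mono_left (nhdsWithin_le_nhds (s := Set.Ioi t))) ?_
    filter_upwards [self_mem_nhdsWithin] with s hs
    exact nonpos_of_mul_nonpos_right (key s) (sub_pos.2 hs)
  · refine ge_of_tendsto (hg.tendsto t |>.mono_left (nhdsWithin_le_nhds (s := Set.Iio t))) ?_
    filter_upwards [self_mem_nhdsWithin] with s hs
    exact nonneg_of_mul_nonpos_right (key s) (sub_neg.2 hs)

/-! ### The maximizing functional for Y. -/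

theorem hahnBanachDual_attains [IsProbabilityMeasure P] {p q α : ℝ}
    (hpq : p.HolderConjugate q) (hα₀ : 0 < α) (hα₁ : α < 1) {Y : Ω → ℝ} {t : ℝ}
    (hY : MemLp Y (ENNReal.ofReal p) P)
    (ht : IsMinOn (infObjective P p α (fun ω => |Y ω|)) Set.univ t)
    (htY : (t : EReal) < essSup (fun ω => ((|Y ω| : ℝ) : EReal)) P) :
    MemLp (hahnBanachDual p Y t) (ENNReal.ofReal q) P ∧ ¬ (hahnBanachDual p Y t =ᵐ[P] 0) ∧
      (∫ ω, Y ω * hahnBanachDual p Y t ω ∂P) / dualNorm P p α (hahnBanachDual p Y t) =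
        evar P p α (fun ω => |Y ω|) := by
  have hX : MemLp (fun ω => |Y ω|) (ENNReal.ofReal p) P := hY.abs
  have hC := one_lt_entropyBound hpq hα₀ hα₁
  have hS := memLp_max_sub hX t
  have h₀ : ∀ ω, 0 ≤ max (|Y ω| - t) 0 := fun _ => le_max_right _ _
  have hV := memLp_rpow_sub_one hpq hS h₀
  have hV₀ : ∀ ω, 0 ≤ max (|Y ω| - t) 0 ^ (p - 1) := fun ω => Real.rpow_nonneg (h₀ ω) _
  have hZ : MemLp (hahnBanachDual p Y t) (ENNReal.ofReal q) P := memLp_sign_mul hY.1 hV hV₀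
  have hVn := lpNorm_rpow_sub_one hpq hS h₀
  have hopt := entropyBound_mul_integral_eq_of_isMinOn hpq hα₀ hα₁ hX ht
  have hint := integral_mul_max_sub_rpow hpq hX t
  have hle := evar_le_infObjective hpq hα₀ hα₁ hX hX (fun _ => le_rfl) t
  have hge := integral_mul_le_evar_mul hpq hα₁ hX hV (ae_of_all _ hV₀) (hVn.trans hopt.symm).le
  have hν := dualNorm_le_integral hpq hα₀ hα₁ hZ hV (fun ω => abs_sign_mul_le _ (hV₀ ω))
    (hVn.trans hopt.symm).le
  have hdual := integral_mul_le_evar_mul_dualNorm hpq hα₀ hα₁ hY hZ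
  have hYZ : ∫ ω, Y ω * hahnBanachDual p Y t ω ∂P =
      ∫ ω, |Y ω| * max (|Y ω| - t) 0 ^ (p - 1) ∂P := by
    simp only [hahnBanachDual, ← mul_assoc, mul_sign_eq_abs]
  have hn : 0 < lpNorm (fun ω => max (|Y ω| - t) 0) (ENNReal.ofReal p) P := by
    refine lpNorm_nonneg.lt_of_ne' fun h => htY.not_ge ?_
    rw [lpNorm_eq_zero hS (ofReal_ne_zero hpq)] at h
    refine essSup_le_of_ae_le _ ?_
    filter_upwards [h] with ω hω
    exact EReal.coe_le_coe (by simpa using hω)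
  -- This makes ρ = t + C n ≥ (C - 1) n positive even when t < 0.
  have hnt : -t ≤ lpNorm (fun ω => max (|Y ω| - t) 0) (ENNReal.ofReal p) P := by
    refine le_trans ?_ (integral_le_lpNorm hpq hS)
    have : ∫ _, -t ∂P ≤ ∫ ω, max (|Y ω| - t) 0 ∂P :=
      integral_mono (integrable_const _) (hS.integrable (one_le_ofReal hpq)) fun ω =>
        le_max_of_le_left (by linarith [abs_nonneg (Y ω)])
    simpa using this
  change evar P p α (fun ω => |Y ω|) ≤ t + entropyBound p α * _ at hle
  set n := lpNorm (fun ω => max (|Y ω| - t) 0) (ENNReal.ofReal p) P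
  set a := ∫ ω, max (|Y ω| - t) 0 ^ (p - 1) ∂P
  set ρ := evar P p α (fun ω => |Y ω|)
  set ν := dualNorm P p α (hahnBanachDual p Y t)
  have ha : 0 < a := pos_of_mul_pos_right (hopt ▸ Real.rpow_pos_of_pos hn _)
    (zero_lt_one.trans hC).le
  rw [← hopt] at hint
  rw [hint] at hge
  have hρa : ρ * a = n * (entropyBound p α * a) + t * a := by
    refine le_antisymm ((mul_le_mul_of_nonneg_right hle ha.le).trans_eq (by ring)) hge
  have hρ : 0 < ρ := by
    have : ρ = t + entropyBound p α * n := mul_right_cancel₀ ha.ne' (by linarith)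
    nlinarith
  rw [hYZ, hint, ← hρa] at hdual ⊢
  have hνa : ν = a := le_antisymm hν (le_of_mul_le_mul_left hdual hρ)
  refine ⟨hZ, fun h => ?_, by rw [hνa, mul_div_cancel_right₀ _ ha.ne']⟩
  rw [hint, ← hρa, integral_eq_zero_of_ae] at hYZ
  · exact (mul_pos hρ ha).ne hYZ
  · filter_upwards [h] with ω hω
    simp [hω]

/-- A vanishing dual norm is harmless: the quotient is then 0 and EVaR(|Y|) ≥ 0. -/
theorem div_dualNorm_le_evar [IsProbabilityMeasure P] {p q α : ℝ}
    (hpq : p.HolderConjugate q) (hα₀ : 0 < α) (hα₁ : α < 1) {Y Z : Ω → ℝ}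
    (hY : MemLp Y (ENNReal.ofReal p) P) (hZ : MemLp Z (ENNReal.ofReal q) P) :
    (∫ ω, Y ω * Z ω ∂P) / dualNorm P p α Z ≤ evar P p α (fun ω => |Y ω|) :=
  div_le_of_le_mul₀ (dualNorm_nonneg hpq hα₀ hα₁ hZ) (evar_abs_nonneg hpq hα₀ hα₁ hY)
    (integral_mul_le_evar_mul_dualNorm hpq hα₀ hα₁ hY hZ)

/-! ### The maximizing random variable for Z. -/

theorem memLp_max_add_rpow [IsFiniteMeasure P] {p q : ℝ} (hpq : p.HolderConjugate q) {Z : Ω → ℝ}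
    (hZ : MemLp Z (ENNReal.ofReal q) P) (t : ℝ) :
    MemLp (fun ω => max (t + |Z ω| ^ (q - 1)) 0) (ENNReal.ofReal p) P := by
  have h := memLp_max_sub (memLp_rpow_sub_one hpq.symm hZ.abs fun _ => abs_nonneg _) (-t)
  simpa [sub_neg_eq_add, add_comm] using h

theorem memLp_hahnBanachPrimal [IsFiniteMeasure P] {p q : ℝ} (hpq : p.HolderConjugate q)
    {Z : Ω → ℝ} (hZ : MemLp Z (ENNReal.ofReal q) P) (t : ℝ) :
    MemLp (hahnBanachPrimal p Z t) (ENNReal.ofReal p) P := by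
  unfold hahnBanachPrimal
  rw [hpq.conjExponent_eq]
  exact memLp_sign_mul hZ.1 (memLp_max_add_rpow hpq hZ t) fun _ => le_max_right _ _

theorem integral_hahnBanachPrimal_mul {p q : ℝ} (hpq : p.HolderConjugate q) (Z : Ω → ℝ) (t : ℝ) :
    ∫ ω, hahnBanachPrimal p Z t ω * Z ω ∂P = ∫ ω, max (t + |Z ω| ^ (q - 1)) 0 * |Z ω| ∂P := by
  congr with ω
  rw [hahnBanachPrimal, hpq.conjExponent_eq, ← mul_sign_eq_abs (Z ω)]
  ring

/-- The threshold is t itself: (t + u)₊ - t ≥ u ≥ 0 for u = |Z|^(q-1), so the outer positive part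
disappears. -/
theorem evar_hahnBanachPrimal_le [IsProbabilityMeasure P] {p q α : ℝ}
    (hpq : p.HolderConjugate q) (hα₀ : 0 < α) (hα₁ : α < 1) {Z : Ω → ℝ}
    (hZ : MemLp Z (ENNReal.ofReal q) P) (t : ℝ) :
    evar P p α (fun ω => |hahnBanachPrimal p Z t ω|) ≤ t + entropyBound p α *
      lpNorm (fun ω => max (t + |Z ω| ^ (q - 1)) 0 - t) (ENNReal.ofReal p) P := by
  have h := evar_le_infObjective hpq hα₀ hα₁ (memLp_hahnBanachPrimal hpq hZ t).abs
    (memLp_max_add_rpow hpq hZ t) (fun ω => by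
      rw [Pi.abs_apply, hahnBanachPrimal, hpq.conjExponent_eq]
      exact abs_sign_mul_le _ (le_max_right _ _)) t
  refine h.trans_eq ?_
  rw [infObjective, entropyBound]
  congr with ω
  refine max_eq_left ?_
  have : 0 ≤ |Z ω| ^ (q - 1) := by positivity
  linarith [le_max_left (t + |Z ω| ^ (q - 1)) 0]

theorem dualObjective_eq {p q : ℝ} (hpq : p.HolderConjugate q) (α : ℝ) (Z : Ω → ℝ) (t : ℝ) :
    dualObjective P p α Z t = (∫ ω, max (t + |Z ω| ^ (q - 1)) 0 * |Z ω| ∂P) /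
      (t + entropyBound p α *
        lpNorm (fun ω => max (t + |Z ω| ^ (q - 1)) 0 - t) (ENNReal.ofReal p) P) := by
  rw [dualObjective, hpq.conjExponent_eq, entropyBound]

theorem dualObjective_nonneg [IsProbabilityMeasure P] {p q α : ℝ} (hpq : p.HolderConjugate q)
    (hα₀ : 0 < α) (hα₁ : α < 1) {Z : Ω → ℝ} (hZ : MemLp Z (ENNReal.ofReal q) P) (t : ℝ) :
    0 ≤ dualObjective P p α Z t := by
  rw [dualObjective_eq hpq]
  exact div_nonneg (integral_nonneg fun _ => by positivity)
    ((evar_abs_nonneg hpq hα₀ hα₁ (memLp_hahnBanachPrimal hpq hZ t)).trans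
      (evar_hahnBanachPrimal_le hpq hα₀ hα₁ hZ t))

/-- Truncating `|Z|` from below at a level where the norm bound is tight gives the value of the
objective of the formula for the dual norm. -/
theorem dualNorm_le_dualObjective_of_lpNorm_max_eq [IsProbabilityMeasure P] {p q α : ℝ}
    (hpq : p.HolderConjugate q) (hα₀ : 0 < α) (hα₁ : α < 1) {Z : Ω → ℝ}
    (hZ : MemLp Z (ENNReal.ofReal q) P) {b : ℝ} (hb : 0 ≤ b)
    (h : lpNorm (fun ω => max |Z ω| b) (ENNReal.ofReal q) P =
      entropyBound p α * ∫ ω, max |Z ω| b ∂P) :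
    dualNorm P p α Z ≤ dualObjective P p α Z (-(b ^ (q - 1))) := by
  have hC := one_lt_entropyBound hpq hα₀ hα₁
  have hq := hpq.symm.sub_one_pos
  have hW : MemLp (fun ω => max |Z ω| b) (ENNReal.ofReal q) P := hZ.abs.sup (memLp_const b)
  have hW₀ : ∀ ω, 0 ≤ max |Z ω| b := fun ω => le_max_of_le_right hb
  have hWU := memLp_rpow_sub_one hpq.symm hW hW₀
  have hν := dualNorm_le_integral hpq hα₀ hα₁ hZ hW (fun ω => le_max_left _ _) h.le
  have hbw : b ≤ lpNorm (fun ω => max |Z ω| b) (ENNReal.ofReal q) P := by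
    refine le_trans ?_ (integral_le_lpNorm hpq.symm hW)
    have : ∫ _, b ∂P ≤ ∫ ω, max |Z ω| b ∂P :=
      integral_mono (integrable_const _) (hW.integrable (one_le_ofReal hpq.symm)) fun ω =>
        le_max_right _ _
    simpa using this
  have hmax : ∀ ω, max |Z ω| b ^ (q - 1) = max (|Z ω| ^ (q - 1)) (b ^ (q - 1)) := fun ω =>
    (Real.monotoneOn_rpow_Ici_of_exponent_nonneg hq.le).map_max
      (Set.mem_Ici.2 (abs_nonneg _)) (Set.mem_Ici.2 hb)
  have hden : ∀ ω, max (-(b ^ (q - 1)) + |Z ω| ^ (q - 1)) 0 - -(b ^ (q - 1)) =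
      max |Z ω| b ^ (q - 1) := fun ω => by
    rw [hmax, sub_neg_eq_add, max_add, neg_add_cancel_comm, zero_add]
  have hnum : ∀ ω, max (-(b ^ (q - 1)) + |Z ω| ^ (q - 1)) 0 * |Z ω| =
      max |Z ω| b * max |Z ω| b ^ (q - 1) - b ^ (q - 1) * max |Z ω| b := fun ω => by
    rcases le_total |Z ω| b with hle | hle
    · have := Real.rpow_le_rpow (abs_nonneg _) hle hq.le
      rw [max_eq_right hle, max_eq_right (by linarith)]
      ring
    · have := Real.rpow_le_rpow hb hle hq.le
      rw [max_eq_left hle, max_eq_left (by linarith)]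
      ring
  have hWi₀ : 0 ≤ ∫ ω, max |Z ω| b ∂P := integral_nonneg hW₀
  -- If E[W] = 0 for W = max(|Z|, b), nonnegativity of the objective suffices; otherwise the
  -- denominator is at least (C - 1)‖W‖_q^(q-1) > 0.
  rcases hWi₀.eq_or_lt with h₀ | h₀
  · rw [← h₀] at hν
    exact hν.trans (dualObjective_nonneg hpq hα₀ hα₁ hZ _)
  refine hν.trans_eq ?_
  have hWi := hW.integrable (one_le_ofReal hpq.symm)
  simp_rw [dualObjective_eq hpq, hden, hnum]
  rw [integral_sub (integrable_mul_of_memLp hpq.symm hW hWU) (hWi.const_mul _),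
    integral_mul_rpow_sub_one_self hpq.symm hW hW₀, integral_const_mul,
    lpNorm_rpow_sub_one hpq.symm hW hW₀]
  have hwq := Real.rpow_le_rpow hb hbw hq.le
  have hw : 0 < lpNorm (fun ω => max |Z ω| b) (ENNReal.ofReal q) P :=
    h ▸ mul_pos (zero_lt_one.trans hC) h₀
  have hwq₀ := Real.rpow_pos_of_pos hw (q - 1)
  rw [eq_div_iff]
  · linear_combination -lpNorm (fun ω => max |Z ω| b) (ENNReal.ofReal q) P ^ (q - 1) * h
  · nlinarith

/-- Intermediate value theorem in b: the norm bound fails or is tight at b = 0 and holds for large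
b. -/
theorem exists_lpNorm_max_eq [IsProbabilityMeasure P] {p q C : ℝ} (hpq : p.HolderConjugate q)
    (hC : 1 < C) {Z : Ω → ℝ} (hZ : MemLp Z (ENNReal.ofReal q) P)
    (h : C * ∫ ω, |Z ω| ∂P ≤ lpNorm Z (ENNReal.ofReal q) P) :
    ∃ b, 0 ≤ b ∧ lpNorm (fun ω => max |Z ω| b) (ENNReal.ofReal q) P =
      C * ∫ ω, max |Z ω| b ∂P := by
  have hZa : MemLp (fun ω => |Z ω|) (ENNReal.ofReal q) P := hZ.abs
  have hW : ∀ b, MemLp (fun ω => max |Z ω| b) (ENNReal.ofReal q) P := fun b =>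
    hZ.abs.sup (memLp_const b)
  have hWi := fun b => (hW b).integrable (one_le_ofReal hpq.symm)
  have hlip : ∀ s r ω, max |Z ω| s ≤ max |Z ω| r + |s - r| := fun s r ω =>
    max_le (by linarith [le_max_left |Z ω| r, abs_nonneg (s - r)])
      (by linarith [le_max_right |Z ω| r, le_abs_self (s - r)])
  have hcn : Continuous fun b => lpNorm (fun ω => max |Z ω| b) (ENNReal.ofReal q) P :=
    continuous_lpNorm_of_lipschitz hpq.symm hW (fun _ ω => le_max_of_le_left (abs_nonneg _)) hlip
  have hci : Continuous fun b => ∫ ω, max |Z ω| b ∂P := by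
    refine (LipschitzWith.of_le_add fun s r => ?_).continuous
    have := integral_mono (hWi s) ((hWi r).add (integrable_const |s - r|)) (hlip s r)
    simp only [Pi.add_apply] at this
    rw [integral_add (hWi r) (integrable_const _)] at this
    simpa [Real.dist_eq] using this
  set n := lpNorm Z (ENNReal.ofReal q) P with hn
  have hn₀ : 0 ≤ n := lpNorm_nonneg
  have hC' : 0 < C - 1 := by linarith
  -- The endpoint b = n/(C - 1) solves n + b = C b.
  have hB : 0 ≤ n / (C - 1) := by positivity
  have hupper : lpNorm (fun ω => max |Z ω| (n / (C - 1))) (ENNReal.ofReal q) P ≤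
      C * ∫ ω, max |Z ω| (n / (C - 1)) ∂P := by
    have h₁ := lpNorm_le_add_of_le (f := fun ω => max |Z ω| (n / (C - 1))) hpq.symm hZa hB
      (fun ω => le_max_of_le_right hB)
      fun ω => max_le (le_add_of_nonneg_right hB) (le_add_of_nonneg_left (abs_nonneg _))
    rw [lpNorm_fun_abs hZ.1, ← hn] at h₁
    have h₂ : ∫ _, n / (C - 1) ∂P ≤ ∫ ω, max |Z ω| (n / (C - 1)) ∂P :=
      integral_mono (integrable_const _) (hWi _) fun ω => le_max_right _ _
    have h₃ : n + n / (C - 1) = C * (n / (C - 1)) := by field_simp; ring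
    simp only [integral_const, probReal_univ, smul_eq_mul, one_mul] at h₂
    exact (h₁.trans_eq h₃).trans (mul_le_mul_of_nonneg_left h₂ (by linarith))
  obtain ⟨b, hb, hb'⟩ := intermediate_value_Icc' hB
    (hcn.sub (continuous_const.mul hci) : Continuous fun b =>
      lpNorm (fun ω => max |Z ω| b) (ENNReal.ofReal q) P - C * ∫ ω, max |Z ω| b ∂P).continuousOn
    (show (0 : ℝ) ∈ _ from ⟨sub_nonpos.2 hupper, by
      simpa [lpNorm_fun_abs hZ.1] using h⟩)
  exact ⟨b, hb.1, sub_eq_zero.1 hb'⟩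

/-- The values of the objective of the formula for the dual norm approach `E|Z|` at infinity. -/
theorem integral_abs_le_of_forall_dualObjective_le [IsProbabilityMeasure P] {p q α : ℝ}
    (hpq : p.HolderConjugate q) (hα₀ : 0 < α) (hα₁ : α < 1) {Z : Ω → ℝ}
    (hZ : MemLp Z (ENNReal.ofReal q) P) {M : ℝ} (hM : ∀ s, dualObjective P p α Z s ≤ M) :
    ∫ ω, |Z ω| ∂P ≤ M := by
  have hC := one_lt_entropyBound hpq hα₀ hα₁
  have hZa : MemLp (fun ω => |Z ω|) (ENNReal.ofReal q) P := hZ.abs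
  have hM₀ : 0 ≤ M := (dualObjective_nonneg hpq hα₀ hα₁ hZ 0).trans (hM 0)
  have hU : ∀ ω, 0 ≤ |Z ω| ^ (q - 1) := fun ω => by positivity
  set n := lpNorm (fun ω => |Z ω| ^ (q - 1)) (ENNReal.ofReal p) P
  have hn : 0 ≤ n := lpNorm_nonneg
  have hCn : 0 ≤ entropyBound p α * n := by positivity
  have key : ∀ s, 0 < s → s * ∫ ω, |Z ω| ∂P ≤ M * (s + entropyBound p α * n) := fun s hs => by
    have hmax : ∀ ω, max (s + |Z ω| ^ (q - 1)) 0 = s + |Z ω| ^ (q - 1) := fun ω =>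
      max_eq_left (add_nonneg hs.le (hU ω))
    have h := hM s
    simp_rw [dualObjective_eq hpq, hmax, add_sub_cancel_left] at h
    rw [div_le_iff₀ (by positivity)] at h
    refine le_trans ?_ h
    rw [← integral_const_mul]
    refine integral_mono ((hZa.integrable (one_le_ofReal hpq.symm)).const_mul s) ?_ fun ω => ?_
    · have := integrable_mul_of_memLp hpq (memLp_max_add_rpow hpq hZ s) hZa
      simpa only [hmax] using this
    · exact mul_le_mul_of_nonneg_right (le_add_of_nonneg_right (hU ω)) (abs_nonneg _)
  by_contra! hlt
  have hd : 0 < ∫ ω, |Z ω| ∂P - M := sub_pos.2 hlt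
  -- At this s, s (E|Z| - M) = M C n + 1, contradicting `key`.
  have hpos : 0 < (M * (entropyBound p α * n) + 1) / (∫ ω, |Z ω| ∂P - M) := by positivity
  have h := key _ hpos
  have : (M * (entropyBound p α * n) + 1) / (∫ ω, |Z ω| ∂P - M) * (∫ ω, |Z ω| ∂P - M) =
      M * (entropyBound p α * n) + 1 := div_mul_cancel₀ _ hd.ne'
  linarith

/-- If |Z| is admissible it is its own majorant, and E|Z| is reached as s → ∞. Otherwise |Z| is
raised to max(|Z|, b) with tight norm bound, whose mean is the objective at -b^(q-1) unless it
vanishes. -/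
theorem dualNorm_le_of_forall_dualObjective_le [IsProbabilityMeasure P] {p q α : ℝ}
    (hpq : p.HolderConjugate q) (hα₀ : 0 < α) (hα₁ : α < 1) {Z : Ω → ℝ}
    (hZ : MemLp Z (ENNReal.ofReal q) P) {M : ℝ} (hM : ∀ s, dualObjective P p α Z s ≤ M) :
    dualNorm P p α Z ≤ M := by
  rcases le_total (lpNorm Z (ENNReal.ofReal q) P) (entropyBound p α * ∫ ω, |Z ω| ∂P) with h | h
  · refine (dualNorm_le_integral hpq hα₀ hα₁ hZ hZ.abs (fun _ => le_rfl) ?_).trans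
      (integral_abs_le_of_forall_dualObjective_le hpq hα₀ hα₁ hZ hM)
    rw [lpNorm_abs hZ.1]
    exact h
  · obtain ⟨b, hb, hbe⟩ := exists_lpNorm_max_eq hpq (one_lt_entropyBound hpq hα₀ hα₁) hZ h
    exact (dualNorm_le_dualObjective_of_lpNorm_max_eq hpq hα₀ hα₁ hZ hb hbe).trans (hM _)

theorem integral_hahnBanachPrimal_mul_eq [IsProbabilityMeasure P] {p q α : ℝ}
    (hpq : p.HolderConjugate q) (hα₀ : 0 < α) (hα₁ : α < 1) {Z : Ω → ℝ}
    (hZ : MemLp Z (ENNReal.ofReal q) P) {t : ℝ}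
    (ht : IsMaxOn (dualObjective P p α Z) Set.univ t) :
    ∫ ω, hahnBanachPrimal p Z t ω * Z ω ∂P =
      evar P p α (fun ω => |hahnBanachPrimal p Z t ω|) * dualNorm P p α Z := by
  have hY := memLp_hahnBanachPrimal hpq hZ t
  have hρ := evar_abs_nonneg hpq hα₀ hα₁ hY
  have hle := evar_hahnBanachPrimal_le hpq hα₀ hα₁ hZ t
  have hν := dualNorm_le_of_forall_dualObjective_le hpq hα₀ hα₁ hZ fun s => ht (Set.mem_univ s)
  have hν₀ := dualNorm_nonneg hpq hα₀ hα₁ hZ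
  refine le_antisymm (integral_mul_le_evar_mul_dualNorm hpq hα₀ hα₁ hY hZ) ?_
  rw [integral_hahnBanachPrimal_mul hpq]
  have hN : 0 ≤ ∫ ω, max (t + |Z ω| ^ (q - 1)) 0 * |Z ω| ∂P :=
    integral_nonneg fun _ => by positivity
  rw [dualObjective_eq hpq] at hν
  rcases hρ.eq_or_lt with h | h
  · rwa [← h, zero_mul]
  · rw [le_div_iff₀ (h.trans_le hle)] at hν
    rw [mul_comm]
    exact (mul_le_mul_of_nonneg_left hle hν₀).trans hν

end EntropicRisk

end

theorem mainTheorem9 {Ω : Type*} [MeasurableSpace Ω] (P : Measure Ω) [IsProbabilityMeasure P]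
    (p q α : ℝ) (hp : 1 < p) (hq : q = p.conjExponent) (hα₀ : 0 < α) (hα₁ : α < 1) :
    -- all suprema involved are finite
    (∀ Y : Ω → ℝ, MemLp Y (ENNReal.ofReal p) P →
      BddAbove (EntropicRisk.evarValues P p α Y)) ∧
    (∀ Z : Ω → ℝ, MemLp Z (ENNReal.ofReal q) P →
      BddAbove (EntropicRisk.dualNormValues P p α Z)) ∧
    -- the maximizing functional for `Y`
    (∀ (Y : Ω → ℝ) (t : ℝ), MemLp Y (ENNReal.ofReal p) P →
      IsMinOn (EntropicRisk.infObjective P p α (fun ω => |Y ω|)) Set.univ t →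
      (t : EReal) < essSup (fun ω => ((|Y ω| : ℝ) : EReal)) P →
      MemLp (EntropicRisk.hahnBanachDual p Y t) (ENNReal.ofReal q) P ∧
      ¬ (EntropicRisk.hahnBanachDual p Y t =ᵐ[P] 0) ∧
      (∫ ω, Y ω * EntropicRisk.hahnBanachDual p Y t ω ∂P) /
          EntropicRisk.dualNorm P p α (EntropicRisk.hahnBanachDual p Y t) =
        EntropicRisk.evar P p α (fun ω => |Y ω|) ∧
      IsGreatest
        {r : ℝ | ∃ Z : Ω → ℝ, MemLp Z (ENNReal.ofReal q) P ∧ ¬ (Z =ᵐ[P] 0) ∧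
          r = (∫ ω, Y ω * Z ω ∂P) / EntropicRisk.dualNorm P p α Z}
        (EntropicRisk.evar P p α (fun ω => |Y ω|))) ∧
    -- the maximizing random variable for `Z`
    (∀ (Z : Ω → ℝ) (t : ℝ), MemLp Z (ENNReal.ofReal q) P →
      IsMaxOn (EntropicRisk.dualObjective P p α Z) Set.univ t →
      MemLp (EntropicRisk.hahnBanachPrimal p Z t) (ENNReal.ofReal p) P ∧
      ∫ ω, EntropicRisk.hahnBanachPrimal p Z t ω * Z ω ∂P =
        EntropicRisk.evar P p α (fun ω => |EntropicRisk.hahnBanachPrimal p Z t ω|) *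
          EntropicRisk.dualNorm P p α Z) := by
  have hpq : p.HolderConjugate q := hq ▸ Real.HolderConjugate.conjExponent hp
  refine ⟨fun Y hY => EntropicRisk.bddAbove_evarValues hpq hα₁ hY,
    fun Z hZ => EntropicRisk.bddAbove_dualNormValues hpq hα₀ hα₁ hZ, fun Y t hY ht htY => ?_,
    fun Z t hZ ht => ⟨EntropicRisk.memLp_hahnBanachPrimal hpq hZ t,
      EntropicRisk.integral_hahnBanachPrimal_mul_eq hpq hα₀ hα₁ hZ ht⟩⟩
  obtain ⟨h₁, h₂, h₃⟩ := EntropicRisk.hahnBanachDual_attains hpq hα₀ hα₁ hY ht htY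
  refine ⟨h₁, h₂, h₃, ⟨_, h₁, h₂, h₃.symm⟩, ?_⟩
  rintro _ ⟨Z, hZ, -, rfl⟩
  exact EntropicRisk.div_dualNorm_le_evar hpq hα₀ hα₁ hY hZ
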